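/- Let $k$ be a field, and let $A=\bigoplus_{i\ge 0}A_i$ and $B=\bigoplus_{i\ge 0}B_i$ be one-generated free $k$-algebras, i.e. $A=k\langle x_1,\dots,x_m\rangle$ and $B=k\langle y_1,\dots,y_n\rangle$ for some integers $m,n\ge 0$, with all generators in degree $1$. A *graded twisting map* is a $k$-linear map $\tau:B\otimes A\to A\otimes B$ (tensor products over $k$) such that $\tau(1\otimes a)=a\otimes 1$ and $\tau(b\otimes 1)=1\otimes b$ for all $a\in A$, $b\in B$, such that $$\tau(\mu_B\otimes\mu_A)=(\mu_A\otimes\mu_B)(1_A\otimes\tau\otimes 1_B)(\tau\otimes\tau)(1_B\otimes\tau\otimes 1_A)$$ on $B\otimes B\otimes A\otimes A$, where $\mu_A,\mu_B$ are the multiplication maps, and such that $\tau\big(\bigoplus_{p+q=d}B_p\otimes A_q\big)\subseteq\bigoplus_{p+q=d}A_p\otimes B_q$ for all $d\ge 0$. The twisted tensor product $A\otimes_\tau B$ is the vector space $A\otimes B$ with the multiplication $(\mu_A\otimes\mu_B)(1_A\otimes\tau\otimes 1_B)$, the unit $1\otimes 1$ and the grading $(A\otimes_\tau B)_d=\bigoplus_{p+q=d}A_p\otimes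 B_q$; it is a connected graded $k$-algebra. A connected, locally finite-dimensional $\mathbb N$-graded $k$-algebra $C$ is *quadratic* if the canonical map $\pi:T(C_1)\to C$ from the tensor algebra is surjective and its kernel is the two-sided ideal generated by $\ker\pi\cap(C_1\otimes C_1)$. It is *Koszul* if the trivial left module $k=C/C_+$, where $C_+=\bigoplus_{i>0}C_i$, admits a resolution $\cdots\to P_2\to P_1\to P_0\to k\to 0$ by graded free left $C$-modules and degree-preserving maps such that each $P_i$ is generated in degree $i$. **Proposition.** Let $A$ and $B$ be one-generated free $k$-algebras and let $\tau:B\otimes A\to A\otimes B$ be any graded twisting map. If $A\otimes_\tau B$ is quadratic, then it is Koszul. -/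

import Mathlib

open scoped TensorProduct DirectSum

noncomputable section

namespace TwistedProduct

/-! ### Twisting maps -/

section TwistingMaps

variable {k : Type*} [Field k]

/-- The map `1 ⊗ f ⊗ 1 : V ⊗ Y ⊗ X ⊗ W → V ⊗ X' ⊗ Y' ⊗ W` induced by a linear map
`f : Y ⊗ X → X' ⊗ Y'`. -/
def applyMiddle (V W : Type*) {X Y X' Y' : Type*}
    [AddCommGroup V] [Module k V] [AddCommGroup W] [Module k W]
    [AddCommGroup X] [Module k X] [AddCommGroup Y] [Module k Y]
    [AddCommGroup X'] [Module k X'] [AddCommGroup Y'] [Module k Y']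
    (f : Y ⊗[k] X →ₗ[k] X' ⊗[k] Y') :
    (V ⊗[k] Y) ⊗[k] (X ⊗[k] W) →ₗ[k] (V ⊗[k] X') ⊗[k] (Y' ⊗[k] W) :=
  (TensorProduct.assoc k (V ⊗[k] X') Y' W).toLinearMap ∘ₗ
    TensorProduct.map
      ((TensorProduct.assoc k V X' Y').symm.toLinearMap ∘ₗ
        TensorProduct.map LinearMap.id f ∘ₗ
        (TensorProduct.assoc k V Y X).toLinearMap)
      LinearMap.id ∘ₗ
    (TensorProduct.assoc k (V ⊗[k] Y) X W).symm.toLinearMap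

variable (k) in
/-- An algebra twisting map `τ : B ⊗ A → A ⊗ B`: a linear map which satisfies the unital twisting
conditions and
`τ (μ_B ⊗ μ_A) = (μ_A ⊗ μ_B) (1 ⊗ τ ⊗ 1) (τ ⊗ τ) (1 ⊗ τ ⊗ 1)` on `B ⊗ B ⊗ A ⊗ A`. -/
structure TwistingMap (A B : Type*) [Ring A] [Algebra k A] [Ring B] [Algebra k B] where
  /-- the underlying linear map -/
  toLinearMap : B ⊗[k] A →ₗ[k] A ⊗[k] B
  map_one_tmul : ∀ a : A, toLinearMap (1 ⊗ₜ[k] a) = a ⊗ₜ[k] 1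
  map_tmul_one : ∀ b : B, toLinearMap (b ⊗ₜ[k] 1) = 1 ⊗ₜ[k] b
  map_mul : toLinearMap ∘ₗ TensorProduct.map (LinearMap.mul' k B) (LinearMap.mul' k A) =
    TensorProduct.map (LinearMap.mul' k A) (LinearMap.mul' k B) ∘ₗ
      applyMiddle A B toLinearMap ∘ₗ
      TensorProduct.map toLinearMap toLinearMap ∘ₗ
      applyMiddle B A toLinearMap

variable {A B : Type*} [Ring A] [Algebra k A] [Ring B] [Algebra k B]

/-- The multiplication `μ_τ = (μ_A ⊗ μ_B) (1 ⊗ τ ⊗ 1)` on `A ⊗ B`. -/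
def TwistingMap.mulMap (τ : TwistingMap k A B) :
    (A ⊗[k] B) ⊗[k] (A ⊗[k] B) →ₗ[k] A ⊗[k] B :=
  TensorProduct.map (LinearMap.mul' k A) (LinearMap.mul' k B) ∘ₗ applyMiddle A B τ.toLinearMap

/-- The underlying space `A ⊗ B` of the twisted tensor product `A ⊗_τ B`. -/
def TwistedTensorProduct (_τ : TwistingMap k A B) : Type _ := A ⊗[k] B

namespace TwistingMap

variable (τ : TwistingMap k A B)

/-- `x ↦ a x b` on `A ⊗ B`, for the obvious left action of `A` and right action of `B`. -/
def sandwich (a : A) (b : B) : A ⊗[k] B →ₗ[k] A ⊗[k] B :=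
  TensorProduct.map (LinearMap.mulLeft k a) (LinearMap.mulRight k b)

@[simp] lemma sandwich_tmul (a x : A) (b y : B) :
    sandwich (k := k) a b (x ⊗ₜ y) = (a * x) ⊗ₜ (y * b) := rfl

lemma sandwich_sandwich (a a' : A) (b b' : B) (t : A ⊗[k] B) :
    sandwich a b (sandwich a' b' t) = sandwich (a * a') (b' * b) t := by
  induction t with
  | zero => simp
  | tmul x y => simp [mul_assoc]
  | add s t hs ht => simp [hs, ht]

lemma sandwich_one (t : A ⊗[k] B) : sandwich (1 : A) (1 : B) t = t := by
  induction t with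
  | zero => simp
  | tmul x y => simp
  | add s t hs ht => simp [hs, ht]

lemma applyMiddle_tmul {V W X Y X' Y' : Type*}
    [AddCommGroup V] [Module k V] [AddCommGroup W] [Module k W]
    [AddCommGroup X] [Module k X] [AddCommGroup Y] [Module k Y]
    [AddCommGroup X'] [Module k X'] [AddCommGroup Y'] [Module k Y']
    (f : Y ⊗[k] X →ₗ[k] X' ⊗[k] Y') (v : V) (y : Y) (x : X) (w : W) :
    applyMiddle V W f ((v ⊗ₜ y) ⊗ₜ (x ⊗ₜ w)) =
      TensorProduct.assoc k (V ⊗[k] X') Y' W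
        ((TensorProduct.assoc k V X' Y').symm (v ⊗ₜ f (y ⊗ₜ x)) ⊗ₜ w) := rfl

lemma mul_applyMiddle_aux (f : B ⊗[k] A →ₗ[k] A ⊗[k] B) (a a' : A) (b b' : B) :
    TensorProduct.map (LinearMap.mul' k A) (LinearMap.mul' k B)
      (applyMiddle A B f ((a ⊗ₜ b) ⊗ₜ (a' ⊗ₜ b'))) = sandwich a b' (f (b ⊗ₜ a')) := by
  rw [applyMiddle_tmul]
  generalize f (b ⊗ₜ a') = t
  induction t with
  | zero => simp
  | tmul x y => simp
  | add s t hs ht => simp [TensorProduct.tmul_add, TensorProduct.add_tmul, hs, ht]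

lemma mulMap_tmul (a a' : A) (b b' : B) :
    τ.mulMap ((a ⊗ₜ b) ⊗ₜ (a' ⊗ₜ b')) = sandwich a b' (τ.toLinearMap (b ⊗ₜ a')) :=
  mul_applyMiddle_aux τ.toLinearMap a a' b b'

/-- `x ⊗ y ↦ x τ(y ⊗ a)`. -/
def pushRight (a : A) : A ⊗[k] B →ₗ[k] A ⊗[k] B :=
  τ.mulMap ∘ₗ (TensorProduct.mk k (A ⊗[k] B) (A ⊗[k] B)).flip (a ⊗ₜ 1)

/-- `x ⊗ y ↦ τ(b ⊗ x) y`. -/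
def pushLeft (b : B) : A ⊗[k] B →ₗ[k] A ⊗[k] B :=
  τ.mulMap ∘ₗ TensorProduct.mk k (A ⊗[k] B) (A ⊗[k] B) (1 ⊗ₜ b)

lemma pushRight_tmul (a x : A) (y : B) :
    τ.pushRight a (x ⊗ₜ y) = sandwich x 1 (τ.toLinearMap (y ⊗ₜ a)) := by
  simp [pushRight, mulMap_tmul]

lemma pushLeft_tmul (b : B) (x : A) (y : B) :
    τ.pushLeft b (x ⊗ₜ y) = sandwich 1 y (τ.toLinearMap (b ⊗ₜ x)) := by
  simp [pushLeft, mulMap_tmul]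

lemma map_tmul_mul (b : B) (a a' : A) :
    τ.toLinearMap (b ⊗ₜ (a * a')) = τ.pushRight a' (τ.toLinearMap (b ⊗ₜ a)) := by
  have h := LinearMap.congr_fun τ.map_mul ((1 ⊗ₜ b) ⊗ₜ (a ⊗ₜ a'))
  simp only [LinearMap.coe_comp, Function.comp_apply, TensorProduct.map_tmul,
    LinearMap.mul'_apply, one_mul] at h
  rw [h, applyMiddle_tmul]
  generalize τ.toLinearMap (b ⊗ₜ a) = t
  induction t with
  | zero => simp
  | tmul x y =>
    simp only [TensorProduct.assoc_symm_tmul, TensorProduct.map_tmul, TensorProduct.assoc_tmul,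
      τ.map_one_tmul, pushRight_tmul]
    generalize τ.toLinearMap (y ⊗ₜ a') = s
    induction s with
    | zero => simp
    | tmul p q =>
      rw [mul_applyMiddle_aux, τ.map_one_tmul]
      simp only [sandwich_tmul, one_mul, mul_one]
    | add s t hs ht => simp only [TensorProduct.tmul_add, map_add, hs, ht]
  | add s t hs ht =>
    simp only [TensorProduct.tmul_add, TensorProduct.add_tmul, map_add, hs, ht]

lemma map_mul_tmul (b b' : B) (a : A) :
    τ.toLinearMap ((b * b') ⊗ₜ a) = τ.pushLeft b (τ.toLinearMap (b' ⊗ₜ a)) := by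
  have h := LinearMap.congr_fun τ.map_mul ((b ⊗ₜ b') ⊗ₜ (a ⊗ₜ 1))
  simp only [LinearMap.coe_comp, Function.comp_apply, TensorProduct.map_tmul,
    LinearMap.mul'_apply, mul_one] at h
  rw [h, applyMiddle_tmul]
  generalize τ.toLinearMap (b' ⊗ₜ a) = t
  induction t with
  | zero => simp
  | tmul x y =>
    simp only [TensorProduct.assoc_symm_tmul, TensorProduct.map_tmul, TensorProduct.assoc_tmul,
      τ.map_tmul_one, pushLeft_tmul]
    generalize τ.toLinearMap (b ⊗ₜ x) = s
    induction s with
    | zero => simp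
    | tmul p q =>
      rw [mul_applyMiddle_aux, τ.map_tmul_one]
      simp only [sandwich_tmul, one_mul, mul_one]
    | add s t hs ht => simp only [TensorProduct.add_tmul, map_add, hs, ht]
  | add s t hs ht =>
    simp only [TensorProduct.tmul_add, TensorProduct.add_tmul, map_add, hs, ht]

lemma mulMap_assoc (x y z : A ⊗[k] B) :
    τ.mulMap (τ.mulMap (x ⊗ₜ y) ⊗ₜ z) = τ.mulMap (x ⊗ₜ τ.mulMap (y ⊗ₜ z)) := by
  induction x with
  | zero => simp
  | add s t hs ht => simp only [TensorProduct.add_tmul, map_add, hs, ht]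
  | tmul a b =>
  induction y with
  | zero => simp
  | add s t hs ht => simp only [TensorProduct.add_tmul, TensorProduct.tmul_add, map_add, hs, ht]
  | tmul a' b' =>
  induction z with
  | zero => simp
  | add s t hs ht => simp only [TensorProduct.tmul_add, map_add, hs, ht]
  | tmul a'' b'' =>
  rw [mulMap_tmul, mulMap_tmul]
  have hL : ∀ t : A ⊗[k] B, τ.mulMap (sandwich a b' t ⊗ₜ (a'' ⊗ₜ b'')) =
      sandwich a b'' (τ.mulMap (t ⊗ₜ τ.toLinearMap (b' ⊗ₜ a''))) := by
    intro t
    induction t with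
    | zero => simp only [map_zero, TensorProduct.zero_tmul]
    | add s t hs ht => simp only [TensorProduct.add_tmul, map_add, hs, ht]
    | tmul x y =>
      rw [sandwich_tmul, mulMap_tmul, map_mul_tmul]
      generalize τ.toLinearMap (b' ⊗ₜ a'') = s
      induction s with
      | zero => simp only [map_zero, TensorProduct.tmul_zero]
      | add s t hs ht => simp only [TensorProduct.tmul_add, map_add, hs, ht]
      | tmul p q => simp [pushLeft_tmul, mulMap_tmul, sandwich_sandwich]
  have hR : ∀ s : A ⊗[k] B, τ.mulMap ((a ⊗ₜ b) ⊗ₜ sandwich a' b'' s) =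
      sandwich a b'' (τ.mulMap (τ.toLinearMap (b ⊗ₜ a') ⊗ₜ s)) := by
    intro s
    induction s with
    | zero => simp only [map_zero, TensorProduct.tmul_zero]
    | add s t hs ht => simp only [TensorProduct.tmul_add, map_add, hs, ht]
    | tmul p q =>
      rw [sandwich_tmul, mulMap_tmul, map_tmul_mul]
      generalize τ.toLinearMap (b ⊗ₜ a') = t
      induction t with
      | zero => simp only [map_zero, TensorProduct.zero_tmul]
      | add s t hs ht => simp only [TensorProduct.add_tmul, map_add, hs, ht]
      | tmul x y => simp [pushRight_tmul, mulMap_tmul, sandwich_sandwich]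
  rw [hL, hR]

lemma one_mulMap (x : A ⊗[k] B) : τ.mulMap ((1 ⊗ₜ 1) ⊗ₜ x) = x := by
  induction x with
  | zero => simp only [map_zero, TensorProduct.tmul_zero]
  | add s t hs ht => simp only [TensorProduct.tmul_add, map_add, hs, ht]
  | tmul a b => simp [mulMap_tmul, τ.map_one_tmul]

lemma mulMap_one (x : A ⊗[k] B) : τ.mulMap (x ⊗ₜ (1 ⊗ₜ 1)) = x := by
  induction x with
  | zero => simp only [map_zero, TensorProduct.zero_tmul]
  | add s t hs ht => simp only [TensorProduct.add_tmul, map_add, hs, ht]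
  | tmul a b => simp [mulMap_tmul, τ.map_tmul_one]

end TwistingMap

/-! ### The twisted tensor product algebra `A ⊗_τ B` -/

namespace TwistedTensorProduct

variable {τ : TwistingMap k A B}

instance : AddCommGroup (TwistedTensorProduct τ) :=
  inferInstanceAs (AddCommGroup (A ⊗[k] B))

instance : Module k (TwistedTensorProduct τ) :=
  inferInstanceAs (Module k (A ⊗[k] B))

variable (τ) in
/-- The identity map `A ⊗ B → A ⊗_τ B`. -/
def of : A ⊗[k] B ≃ₗ[k] TwistedTensorProduct τ := LinearEquiv.refl k (A ⊗[k] B)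

instance : One (TwistedTensorProduct τ) := ⟨of τ (1 ⊗ₜ 1)⟩

instance : Mul (TwistedTensorProduct τ) :=
  ⟨fun x y => of τ (τ.mulMap ((of τ).symm x ⊗ₜ (of τ).symm y))⟩

lemma one_def : (1 : TwistedTensorProduct τ) = of τ (1 ⊗ₜ 1) := rfl

lemma mul_def (x y : TwistedTensorProduct τ) :
    x * y = of τ (τ.mulMap ((of τ).symm x ⊗ₜ (of τ).symm y)) := rfl

instance : Ring (TwistedTensorProduct τ) where
  __ := (inferInstance : AddCommGroup (TwistedTensorProduct τ))
  left_distrib x y z := by simp only [mul_def, map_add, TensorProduct.tmul_add]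
  right_distrib x y z := by simp only [mul_def, map_add, TensorProduct.add_tmul]
  zero_mul x := by simp only [mul_def, map_zero, TensorProduct.zero_tmul]
  mul_zero x := by simp only [mul_def, map_zero, TensorProduct.tmul_zero]
  mul_assoc x y z := by
    simp only [mul_def, LinearEquiv.symm_apply_apply, TwistingMap.mulMap_assoc]
  one_mul x := by
    simp only [mul_def, one_def, LinearEquiv.symm_apply_apply, TwistingMap.one_mulMap,
      LinearEquiv.apply_symm_apply]
  mul_one x := by
    simp only [mul_def, one_def, LinearEquiv.symm_apply_apply, TwistingMap.mulMap_one,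
      LinearEquiv.apply_symm_apply]

instance : Algebra k (TwistedTensorProduct τ) :=
  Algebra.ofModule
    (fun r x y => by simp only [mul_def, map_smul, ← TensorProduct.smul_tmul'])
    (fun r x y => by simp only [mul_def, map_smul, TensorProduct.tmul_smul])

end TwistedTensorProduct

end TwistingMaps

/-! ### Graded twisting maps -/

section Graded

variable {k : Type*} [Field k]

/-- The Künneth grading `(V ⊗ W)_n = ⨁_{p + q = n} V_p ⊗ W_q`. -/
def kunneth {V W : Type*} [AddCommGroup V] [Module k V] [AddCommGroup W] [Module k W]
    (𝒱 : ℕ → Submodule k V) (𝒲 : ℕ → Submodule k W) (n : ℕ) : Submodule k (V ⊗[k] W) :=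
  Submodule.span k {t | ∃ p q, p + q = n ∧ ∃ v ∈ 𝒱 p, ∃ w ∈ 𝒲 q, v ⊗ₜ[k] w = t}

variable {A B : Type*} [Ring A] [Algebra k A] [Ring B] [Algebra k B]

/-- A graded twisting map: a twisting map `τ : B ⊗ A → A ⊗ B` which preserves the Künneth
grading, `τ((B ⊗ A)_n) ⊆ (A ⊗ B)_n`. -/
structure GradedTwistingMap (𝒜 : ℕ → Submodule k A) [GradedAlgebra 𝒜]
    (ℬ : ℕ → Submodule k B) [GradedAlgebra ℬ] extends TwistingMap k A B where
  map_mem : ∀ n, ∀ t ∈ kunneth ℬ 𝒜 n, toLinearMap t ∈ kunneth 𝒜 ℬ n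

namespace GradedTwistingMap

variable {𝒜 : ℕ → Submodule k A} [GradedAlgebra 𝒜] {ℬ : ℕ → Submodule k B} [GradedAlgebra ℬ]

/-- The algebra `A ⊗_τ B` of a graded twisting map `τ`. -/
abbrev Product (τ : GradedTwistingMap 𝒜 ℬ) : Type _ := TwistedTensorProduct τ.toTwistingMap

/-- The Künneth grading of the algebra `A ⊗_τ B`. -/
def grading (τ : GradedTwistingMap 𝒜 ℬ) (n : ℕ) : Submodule k τ.Product :=
  (kunneth 𝒜 ℬ n).map (TwistedTensorProduct.of τ.toTwistingMap).toLinearMap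

lemma sandwich_mem {p q n m : ℕ} {a : A} {b : B} (ha : a ∈ 𝒜 p) (hb : b ∈ ℬ q)
    {t : A ⊗[k] B} (ht : t ∈ kunneth 𝒜 ℬ n) (hm : p + n + q = m) :
    TwistingMap.sandwich a b t ∈ kunneth 𝒜 ℬ m := by
  induction ht using Submodule.span_induction with
  | mem t h =>
    obtain ⟨i, j, hij, v, hv, w, hw, rfl⟩ := h
    exact Submodule.subset_span ⟨p + i, j + q, by omega, a * v, SetLike.mul_mem_graded ha hv,
      w * b, SetLike.mul_mem_graded hw hb, rfl⟩
  | zero => simp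
  | add x y _ _ hx hy => rw [map_add]; exact add_mem hx hy
  | smul r x _ hx => rw [map_smul]; exact Submodule.smul_mem _ r hx

lemma mulMap_mem (τ : GradedTwistingMap 𝒜 ℬ) {i j : ℕ} {s t : A ⊗[k] B}
    (hs : s ∈ kunneth 𝒜 ℬ i) (ht : t ∈ kunneth 𝒜 ℬ j) :
    τ.mulMap (s ⊗ₜ t) ∈ kunneth 𝒜 ℬ (i + j) := by
  induction hs using Submodule.span_induction with
  | zero => simp
  | add x y _ _ hx hy => rw [TensorProduct.add_tmul, map_add]; exact add_mem hx hy
  | smul r x _ hx =>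
    rw [← TensorProduct.smul_tmul', map_smul]; exact Submodule.smul_mem _ r hx
  | mem s h =>
    obtain ⟨p, q, hpq, v, hv, w, hw, rfl⟩ := h
    induction ht using Submodule.span_induction with
    | zero => simp
    | add x y _ _ hx hy => rw [TensorProduct.tmul_add, map_add]; exact add_mem hx hy
    | smul r x _ hx =>
      rw [TensorProduct.tmul_smul, map_smul]; exact Submodule.smul_mem _ r hx
    | mem t h =>
      obtain ⟨p', q', hpq', v', hv', w', hw', rfl⟩ := h
      rw [TwistingMap.mulMap_tmul]
      exact sandwich_mem hv hw'
        (τ.map_mem (q + p') _ (Submodule.subset_span ⟨q, p', rfl, w, hw, v', hv', rfl⟩))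
        (by omega)

instance (τ : GradedTwistingMap 𝒜 ℬ) : SetLike.GradedMonoid τ.grading where
  one_mem := ⟨1 ⊗ₜ 1, Submodule.subset_span ⟨0, 0, rfl, 1, SetLike.one_mem_graded 𝒜, 1,
    SetLike.one_mem_graded ℬ, rfl⟩, rfl⟩
  mul_mem := by
    rintro i j _ _ ⟨s, hs, rfl⟩ ⟨t, ht, rfl⟩
    exact ⟨_, mulMap_mem τ hs ht, rfl⟩

/-- The piece `A_p ⊗ B_q → (A ⊗_τ B)_{p + q}` of the Künneth grading. -/
def piece (τ : GradedTwistingMap 𝒜 ℬ) (p q : ℕ) :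
    𝒜 p →ₗ[k] ℬ q →ₗ[k] ⨁ n, τ.grading n :=
  LinearMap.mk₂ k (fun a b => DirectSum.lof k ℕ (fun n => τ.grading n) (p + q)
      ⟨TwistedTensorProduct.of _ ((a : A) ⊗ₜ (b : B)), Submodule.mem_map_of_mem
        (Submodule.subset_span ⟨p, q, rfl, a, a.2, b, b.2, rfl⟩)⟩)
    (fun a a' b => by
      rw [← map_add]; congr 1; ext; simp [TensorProduct.add_tmul])
    (fun r a b => by
      rw [← map_smul]; congr 1)
    (fun a b b' => by
      rw [← map_add]; congr 1; ext; simp [TensorProduct.tmul_add])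
    (fun r a b => by
      rw [← map_smul]; congr 1; ext; simp [TensorProduct.tmul_smul])

/-- The decomposition of `A ⊗_τ B` into homogeneous components. -/
def decomposeMap (τ : GradedTwistingMap 𝒜 ℬ) : τ.Product →ₗ[k] ⨁ n, τ.grading n :=
  TensorProduct.lift
    ((LinearMap.compl₁₂
      (DirectSum.toModule k ℕ _ fun p => LinearMap.flip
        (DirectSum.toModule k ℕ _ fun q => (τ.piece p q).flip))
      (DirectSum.decomposeLinearEquiv 𝒜).toLinearMap
      (DirectSum.decomposeLinearEquiv ℬ).toLinearMap)) ∘ₗ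
    (TwistedTensorProduct.of τ.toTwistingMap).symm.toLinearMap

lemma decomposeMap_of_mem (τ : GradedTwistingMap 𝒜 ℬ) {p q : ℕ} {a : A} {b : B}
    (ha : a ∈ 𝒜 p) (hb : b ∈ ℬ q) :
    τ.decomposeMap (TwistedTensorProduct.of _ (a ⊗ₜ b)) = τ.piece p q ⟨a, ha⟩ ⟨b, hb⟩ := by
  simp only [decomposeMap, LinearMap.coe_comp, LinearEquiv.coe_coe, Function.comp_apply,
    LinearEquiv.symm_apply_apply, TensorProduct.lift.tmul, LinearMap.compl₁₂_apply,
    DirectSum.decomposeLinearEquiv_apply, DirectSum.decompose_of_mem _ ha,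
    DirectSum.decompose_of_mem _ hb, ← DirectSum.lof_eq_of k, DirectSum.toModule_lof,
    LinearMap.flip_apply]

/-- `A ⊗_τ B` is a graded algebra. -/
instance (τ : GradedTwistingMap 𝒜 ℬ) : GradedAlgebra τ.grading :=
  { (inferInstance : SetLike.GradedMonoid τ.grading) with
    toDecomposition := DirectSum.Decomposition.ofLinearMap τ.grading τ.decomposeMap
      (by
        rw [LinearMap.ext_iff]
        intro x
        obtain ⟨t, rfl⟩ := (TwistedTensorProduct.of τ.toTwistingMap).surjective x
        induction t with
        | zero => simp
        | add s t hs ht => simp only [map_add, hs, ht]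
        | tmul a b =>
          induction a using DirectSum.Decomposition.inductionOn 𝒜 with
          | zero => simp
          | add a a' ha ha' => simp only [TensorProduct.add_tmul, map_add, ha, ha']
          | homogeneous a =>
            induction b using DirectSum.Decomposition.inductionOn ℬ with
            | zero => simp
            | add b b' hb hb' => simp only [TensorProduct.tmul_add, map_add, hb, hb']
            | homogeneous b =>
              rw [LinearMap.comp_apply, decomposeMap_of_mem τ a.2 b.2]
              simp [piece])
      (by
        ext n ⟨x, t, ht, rfl⟩ : 2
        simp only [LinearMap.coe_comp, Function.comp_apply, LinearMap.id_coe, id_eq,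
          DirectSum.coeLinearMap_lof]
        suffices h : ∀ (x : τ.Product) (hx : x ∈ τ.grading n),
            x = TwistedTensorProduct.of _ t →
            τ.decomposeMap x = DirectSum.lof k ℕ (fun n => τ.grading n) n ⟨x, hx⟩ from
          h _ _ rfl
        induction ht using Submodule.span_induction with
        | zero =>
          rintro x hx rfl
          simp only [map_zero]
          exact (map_zero (DirectSum.lof k ℕ (fun n => τ.grading n) n)).symm
        | add s t hs ht hs' ht' =>
          intro x hx hxe
          have hs₁ := hs' (TwistedTensorProduct.of _ s) ⟨s, hs, rfl⟩ rfl
          have ht₁ := ht' (TwistedTensorProduct.of _ t) ⟨t, ht, rfl⟩ rfl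
          rw [map_add] at hxe
          subst hxe
          rw [(τ.decomposeMap).map_add, hs₁, ht₁, ← map_add]
          congr 1
        | smul r t ht ht' =>
          intro x hx hxe
          have ht₁ := ht' (TwistedTensorProduct.of _ t) ⟨t, ht, rfl⟩ rfl
          rw [map_smul] at hxe
          subst hxe
          rw [(τ.decomposeMap).map_smul, ht₁, ← map_smul]
          congr 1
        | mem t h =>
          obtain ⟨p, q, rfl, a, ha, b, hb, rfl⟩ := h
          rintro x hx rfl
          rw [decomposeMap_of_mem τ ha hb]
          rfl) }

end GradedTwistingMap

end Graded

/-! ### Quadratic and Koszul algebras -/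

section Koszul

universe u v

variable {k : Type u} [Field k] {A : Type v} [Ring A] [Algebra k A]

section Quadratic

variable (𝒜 : ℕ → Submodule k A)

/-- The canonical multiplication map `π : T(A_1) → A`. -/
def canonicalMap : TensorAlgebra k (𝒜 1) →ₐ[k] A :=
  TensorAlgebra.lift k (𝒜 1).subtype

/-- `A` is one-generated if `π : T(A_1) → A` is surjective. -/
def IsOneGenerated : Prop := Function.Surjective (canonicalMap 𝒜)

/-- The ideal `⟨ker π ∩ (A_1 ⊗ A_1)⟩` of `T(A_1)`; here `A_1 ⊗ A_1` is the second power of the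
submodule `A_1` of `T(A_1)`. -/
def quadraticIdeal : TwoSidedIdeal (TensorAlgebra k (𝒜 1)) :=
  TwoSidedIdeal.span
    {t | t ∈ LinearMap.range (TensorAlgebra.ι k (M := 𝒜 1)) ^ 2 ∧ canonicalMap 𝒜 t = 0}

/-- The quadratic part `q(A) = T(A_1) / ⟨ker π ∩ (A_1 ⊗ A_1)⟩`. -/
abbrev QuadraticPart : Type _ := (quadraticIdeal 𝒜).ringCon.Quotient

lemma quadraticIdeal_le :
    (quadraticIdeal 𝒜).ringCon ≤ RingCon.ker (canonicalMap 𝒜).toRingHom := by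
  have h : quadraticIdeal 𝒜 ≤ TwoSidedIdeal.ker (canonicalMap 𝒜) :=
    TwoSidedIdeal.span_le.2 fun t ht => TwoSidedIdeal.mem_ker _ |>.2 ht.2
  intro x y hxy
  have := h ((TwoSidedIdeal.rel_iff _ _ _).1 hxy)
  rw [TwoSidedIdeal.mem_ker, map_sub, sub_eq_zero] at this
  exact this

/-- The canonical map `q(A) → A`. -/
def quadraticPartMap : QuadraticPart 𝒜 →ₐ[k] A :=
  RingCon.liftₐ _ (canonicalMap 𝒜) (quadraticIdeal_le 𝒜)

/-- `A` is quadratic if it is one-generated and the canonical map `q(A) → A` is an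
isomorphism. -/
def IsQuadratic : Prop :=
  IsOneGenerated 𝒜 ∧ Function.Bijective (quadraticPartMap 𝒜)

/-- `A` is a one-generated free algebra `k⟨x_1, …, x_m⟩`: it is freely generated, as an algebra,
by finitely many elements of degree one. -/
def IsFreeOneGenerated : Prop :=
  ∃ (m : ℕ) (x : Fin m → A), (∀ i, x i ∈ 𝒜 1) ∧ Function.Bijective (FreeAlgebra.lift k x)

end Quadratic

section Resolution

/-- The degree `n` part of the graded free left `A`-module `A(-i)^{(S)}`, whose basis vectors
have degree `i`: the families with entries in `A(-i)_n = A_{n-i}`. -/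
def freeGrading (𝒜 : ℕ → Submodule k A) (S : Type*) (i n : ℕ) : Submodule k (S →₀ A) where
  carrier := {f | ∀ s, f s ∈ if i ≤ n then 𝒜 (n - i) else ⊥}
  add_mem' hf hg s := add_mem (hf s) (hg s)
  zero_mem' _ := zero_mem _
  smul_mem' r _ hf s := Submodule.smul_mem _ r (hf s)

variable (𝒜 : ℕ → Submodule k A) [GradedAlgebra 𝒜]

/-- The left ideal `A_+ = ⨁_{i > 0} A_i`. -/
def augmentationIdeal : Submodule A A := (HomogeneousIdeal.irrelevant 𝒜).toIdeal

/-- The connected graded algebra `A` is Koszul: the trivial left module `k = A / A_+` has a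
resolution `⋯ → P_2 → P_1 → P_0 → k → 0` by graded free left `A`-modules and degree preserving
`A`-linear maps, with `P_i` generated in degree `i`. The module `P_i` is the free module on a set
`S i` of vectors of degree `i`. The augmentation `P_0 → A / A_+`, whose target is concentrated
in degree zero, preserves degrees automatically as `P_0` is generated in degree zero. -/
def IsKoszul : Prop :=
  ∃ (S : ℕ → Type v)
    (d : ∀ i, (S (i + 1) →₀ A) →ₗ[A] (S i →₀ A))
    (ε : (S 0 →₀ A) →ₗ[A] A ⧸ augmentationIdeal 𝒜),
    (∀ i n, ∀ f ∈ freeGrading 𝒜 (S (i + 1)) (i + 1) n, d i f ∈ freeGrading 𝒜 (S i) i n) ∧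
    Function.Surjective ε ∧
    Function.Exact (d 0) ε ∧
    ∀ i, Function.Exact (d (i + 1)) (d i)

end Resolution

end Koszul

end TwistedProduct

end

/-!
# Quadratic twisted tensor products of free algebras are Koszul

Let `C = A ⊗_τ B`, with `A` and `B` free on `m` and `n` generators of degree one. As a graded vector
space `C` is `A ⊗ B`, so its Hilbert series is `1 / ((1 - m t) (1 - n t))`, whatever `τ` is
(`exists_finrank_grading`). Equivalently, `h_{d+2} + m n h_d = (m + n) h_{d+1}` for the dimensions
`h_d` of the graded pieces.

Let `R` be the kernel of `C_1 ⊗ C_1 → C_2`. If `C` is quadratic, then the complex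
`0 → C ⊗ R → C ⊗ C_1 → C → k → 0` is exact except possibly at `C ⊗ R`
(`mem_augmentationIdeal_iff`, `exact_relationMap_multiplicationMap`). This is seen with Fox
derivatives, the map `D : T(C_1) → C ⊗ C_1`, `D(t v) = t ⊗ v`. Every element of the kernel of
`C ⊗ C_1 → C` is `D(t)` for some `t` in the kernel of `T(C_1) → C`, which is the ideal generated
by the quadratic relations, and `D` maps that ideal into the image of `C ⊗ R`.

In each degree `d + 2` the kernel of `C ⊗ R → C ⊗ C_1` therefore has dimension
`h_{d+2} - (m + n) h_{d+1} + (dim R) h_d`. As `dim R = m n`, this vanishes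
(`isKoszul_of_isQuadratic`), and the complex is a linear free resolution of `k`.
-/

noncomputable section

namespace TwistedProduct

/-! ### Fox derivatives on the tensor algebra -/

section UnitTensor

variable {k C V ι : Type*} [Field k] [Ring C] [Algebra k C] [AddCommMonoid V] [Module k V]
  (b : Module.Basis ι k V)

/-- The inclusion `V → C ⊗ V`, `v ↦ 1 ⊗ v`, where `C ⊗ V` is written in coordinates as `ι →₀ C` by
means of the basis `b` of `V`. -/
def unitTensor : V →ₗ[k] (ι →₀ C) :=
  Finsupp.mapRange.linearMap (Algebra.linearMap k C) ∘ₗ b.repr.toLinearMap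

lemma unitTensor_basis (i : ι) : unitTensor (C := C) b (b i) = Finsupp.single i 1 := by
  simp [unitTensor]

end UnitTensor

section FoxDerivative

universe u

variable {k V ι : Type*} {C : Type u} [Field k] [Ring C] [Algebra k C] [AddCommGroup V] [Module k V]
  (φ : V →ₗ[k] C) (b : Module.Basis ι k V)

/-- The action of `T(V)` on `(C ⊗ V) × k` in which `v` sends `(f, c)` to `(φ(v) f + c (1 ⊗ v), 0)`.
An element `t` sends `(0, 1)` to its Fox derivative together with its augmentation. -/
def foxAction : TensorAlgebra k V →ₐ[k] Module.End k ((ι →₀ C) × k) :=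
  TensorAlgebra.lift k <| LinearMap.mk₂ k
    (fun v p => (φ v • p.1 + p.2 • unitTensor b v, 0))
    (fun v w p => by simp only [map_add, add_smul, smul_add, Prod.mk_add_mk, add_zero]; abel_nf)
    (fun r v p => by simp only [map_smul, smul_assoc, smul_add, Prod.smul_mk, smul_zero,
      smul_comm r p.2])
    (fun v p q => by
      simp only [Prod.fst_add, Prod.snd_add, add_smul, smul_add, Prod.mk_add_mk, add_zero]; abel_nf)
    (fun r v p => by simp only [Prod.smul_fst, Prod.smul_snd, smul_add, Prod.smul_mk, smul_zero,
      smul_assoc, smul_comm (φ v) r])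

/-- The Fox derivative `D : T(V) → C ⊗ V`, `D(t v) = t ⊗ v`: it records the last tensor factor
of `t` and maps the remaining ones to `C`. -/
def foxDerivative : TensorAlgebra k V →ₗ[k] (ι →₀ C) :=
  LinearMap.fst k _ _ ∘ₗ LinearMap.applyₗ ((0, 1) : (ι →₀ C) × k) ∘ₗ (foxAction φ b).toLinearMap

lemma foxDerivative_apply (t : TensorAlgebra k V) :
    foxDerivative φ b t = (foxAction φ b t (0, 1)).1 := rfl

lemma foxAction_ι (v : V) (p : (ι →₀ C) × k) :
    foxAction φ b (TensorAlgebra.ι k v) p = (φ v • p.1 + p.2 • unitTensor b v, 0) := by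
  simp [foxAction]

lemma foxAction_apply (t : TensorAlgebra k V) (p : (ι →₀ C) × k) :
    foxAction φ b t p =
      (TensorAlgebra.lift k φ t • p.1 + p.2 • foxDerivative φ b t,
        p.2 * TensorAlgebra.algebraMapInv t) := by
  simp only [foxDerivative_apply]
  induction t using TensorAlgebra.induction generalizing p with
  | algebraMap r =>
    ext <;> simp [Algebra.algebraMap_eq_smul_one, mul_comm]
  | ι v =>
    simp [foxAction_ι, TensorAlgebra.algebraMapInv]
  | mul s t hs ht =>
    rw [map_mul, Module.End.mul_apply, Module.End.mul_apply, hs, ht, hs (foxAction φ b t (0, 1)),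
      ht (0, 1)]
    simp only [map_mul, mul_smul, smul_add, add_assoc, smul_comm p.2, one_smul, smul_zero, zero_add,
      one_mul, mul_assoc, mul_comm (TensorAlgebra.algebraMapInv s)]
  | add s t hs ht =>
    rw [map_add, LinearMap.add_apply, LinearMap.add_apply, hs, ht]
    simp only [map_add, add_smul, smul_add, mul_add, Prod.mk_add_mk, Prod.fst_add]
    abel_nf

lemma foxDerivative_ι (v : V) :
    foxDerivative φ b (TensorAlgebra.ι k v) = unitTensor b v := by
  simp [foxDerivative_apply, foxAction_ι]

lemma foxDerivative_algebraMap (r : k) :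
    foxDerivative φ b (algebraMap k (TensorAlgebra k V) r) = 0 := by
  simp [foxDerivative_apply]

lemma foxDerivative_mul (s t : TensorAlgebra k V) :
    foxDerivative φ b (s * t) = TensorAlgebra.lift k φ s • foxDerivative φ b t +
      TensorAlgebra.algebraMapInv t • foxDerivative φ b s := by
  rw [foxDerivative_apply φ b (s * t), map_mul, Module.End.mul_apply, foxAction_apply φ b t,
    foxAction_apply φ b s]
  simp

lemma foxDerivative_mul_ι (s : TensorAlgebra k V) (v : V) :
    foxDerivative φ b (s * TensorAlgebra.ι k v) = TensorAlgebra.lift k φ s • unitTensor b v := by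
  simp [foxDerivative_mul, foxDerivative_ι, TensorAlgebra.algebraMapInv]

/-- The map `C ⊗ V → C`, `c ⊗ v ↦ c φ(v)`. Its target is written as the free module on one
vector. -/
def multiplicationMap : (ι →₀ C) →ₗ[C] (PUnit.{u + 1} →₀ C) :=
  Finsupp.linearCombination C fun i => Finsupp.single PUnit.unit (φ (b i))

lemma multiplicationMap_unitTensor (v : V) :
    multiplicationMap φ b (unitTensor b v) = Finsupp.single PUnit.unit (φ v) := by
  have h : (multiplicationMap φ b).restrictScalars k ∘ₗ unitTensor b =
      Finsupp.lsingle PUnit.unit ∘ₗ φ :=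
    b.ext fun i => by simp [multiplicationMap, unitTensor_basis]
  exact LinearMap.congr_fun h v

/-- The fundamental formula of Fox calculus. -/
lemma multiplicationMap_foxDerivative (t : TensorAlgebra k V) :
    multiplicationMap φ b (foxDerivative φ b t) = Finsupp.single PUnit.unit
      (TensorAlgebra.lift k φ t - algebraMap k C (TensorAlgebra.algebraMapInv t)) := by
  induction t using TensorAlgebra.induction with
  | algebraMap r => simp [foxDerivative_algebraMap]
  | ι v => simp [foxDerivative_ι, multiplicationMap_unitTensor, TensorAlgebra.algebraMapInv]
  | add s t hs ht => 
    rw [map_add, map_add, hs, ht, ← Finsupp.single_add]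
    simp only [map_add]
    congr 1; abel
  | mul s t hs ht =>
    rw [foxDerivative_mul, map_add, map_smul, ← algebraMap_smul C, map_smul, hs, ht,
      Finsupp.smul_single, Finsupp.smul_single, ← Finsupp.single_add]
    simp only [smul_eq_mul, map_mul, mul_sub]
    congr 1
    rw [(Algebra.commutes (TensorAlgebra.algebraMapInv t) (TensorAlgebra.lift k φ s)),
      Algebra.commutes (TensorAlgebra.algebraMapInv s)]
    abel

/-- The Fox derivatives of the elements of a two-sided ideal lie in the left submodule spanned by
those of the generators, if the generators are killed by `T(V) → C` and by the augmentation. -/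
lemma foxDerivative_mem_of_mem_span {R : Set (TensorAlgebra k V)} (N : Submodule C (ι →₀ C))
    (hR : ∀ r ∈ R, TensorAlgebra.lift k φ r = 0 ∧ TensorAlgebra.algebraMapInv r = 0 ∧
      foxDerivative φ b r ∈ N) {t : TensorAlgebra k V} (ht : t ∈ TwoSidedIdeal.span R) :
    foxDerivative φ b t ∈ N := by
  have hN : ∀ (c : k) {f : ι →₀ C}, f ∈ N → c • f ∈ N := fun c f hf => by
    rw [← algebraMap_smul C]; exact N.smul_mem _ hf
  let J : TwoSidedIdeal (TensorAlgebra k V) := TwoSidedIdeal.mk'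
    {t | TensorAlgebra.lift k φ t = 0 ∧ TensorAlgebra.algebraMapInv t = 0 ∧ foxDerivative φ b t ∈ N}
    (by simp)
    (by rintro x y ⟨hx, hx', hx''⟩ ⟨hy, hy', hy''⟩
        exact ⟨by simp [hx, hy], by simp [hx', hy'], by rw [map_add]; exact add_mem hx'' hy''⟩)
    (by rintro x ⟨hx, hx', hx''⟩
        exact ⟨by simp [hx], by simp [hx'], by rw [map_neg]; exact neg_mem hx''⟩)
    (by rintro x y ⟨hy, hy', hy''⟩
        refine ⟨by simp [hy], by simp [hy'], ?_⟩
        rw [foxDerivative_mul, hy', zero_smul, add_zero]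
        exact N.smul_mem _ hy'')
    (by rintro x y ⟨hx, hx', hx''⟩
        refine ⟨by simp [hx], by simp [hx'], ?_⟩
        rw [foxDerivative_mul, hx, zero_smul, zero_add]
        exact hN _ hx'')
  have hJ : TwoSidedIdeal.span R ≤ J :=
    TwoSidedIdeal.span_le.2 fun r hr => (TwoSidedIdeal.mem_mk' ..).2 (hR r hr)
  exact ((TwoSidedIdeal.mem_mk' ..).1 (hJ ht)).2.2

end FoxDerivative

/-! ### Homogeneous parts of free modules -/

section HomogeneousParts

variable {k C : Type*} [Field k] [Ring C] [Algebra k C] (𝒞 : ℕ → Submodule k C)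

/-- The families of elements of `C_n`, as a subspace of the free module `S →₀ C`. -/
def homogeneousPart (S : Type*) (n : ℕ) : Submodule k (S →₀ C) :=
  Finsupp.submodule fun _ => 𝒞 n

variable {𝒞} {S S' : Type*}

lemma mem_homogeneousPart {n : ℕ} {f : S →₀ C} :
    f ∈ homogeneousPart 𝒞 S n ↔ ∀ s, f s ∈ 𝒞 n := by
  simp [homogeneousPart, Finsupp.mem_submodule_iff]

/-- For finite `S`, the space `homogeneousPart 𝒞 S n` is `S → C_n`. -/
def homogeneousPartEquiv [Finite S] (n : ℕ) : homogeneousPart 𝒞 S n ≃ₗ[k] (S → 𝒞 n) where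
  toFun f s := ⟨f.1 s, mem_homogeneousPart.1 f.2 s⟩
  invFun g := ⟨Finsupp.equivFunOnFinite.symm fun s => (g s : C),
    mem_homogeneousPart.2 fun s => (g s).2⟩
  map_add' _ _ := rfl
  map_smul' _ _ := rfl
  left_inv f := by ext; simp
  right_inv g := by ext; simp

instance [Finite S] (n : ℕ) [Module.Finite k (𝒞 n)] : Module.Finite k (homogeneousPart 𝒞 S n) :=
  Module.Finite.equiv (homogeneousPartEquiv n).symm

lemma finrank_homogeneousPart [Finite S] (n : ℕ) [Module.Finite k (𝒞 n)] :
    Module.finrank k (homogeneousPart 𝒞 S n) = Nat.card S * Module.finrank k (𝒞 n) := by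
  have := Fintype.ofFinite S
  rw [(homogeneousPartEquiv (𝒞 := 𝒞) (S := S) n).finrank_eq, Module.finrank_pi_fintype,
    Finset.sum_const, Finset.card_univ, Nat.card_eq_fintype_card, smul_eq_mul]

variable (𝒞) in
/-- The projection of `S →₀ C` onto the families of elements of `C_n`. -/
def homogeneousProj [GradedAlgebra 𝒞] (S : Type*) (n : ℕ) : (S →₀ C) →ₗ[k] (S →₀ C) :=
  Finsupp.mapRange.linearMap (GradedAlgebra.proj 𝒞 n)

variable [GradedAlgebra 𝒞]

lemma homogeneousProj_apply (n : ℕ) (f : S →₀ C) (s : S) :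
    homogeneousProj 𝒞 S n f s = DirectSum.decompose 𝒞 (f s) n := rfl

lemma homogeneousProj_mem (n : ℕ) (f : S →₀ C) :
    homogeneousProj 𝒞 S n f ∈ homogeneousPart 𝒞 S n :=
  mem_homogeneousPart.2 fun s => by rw [homogeneousProj_apply]; exact SetLike.coe_mem _

lemma homogeneousProj_of_mem {n : ℕ} {f : S →₀ C} (hf : f ∈ homogeneousPart 𝒞 S n) :
    homogeneousProj 𝒞 S n f = f := by
  ext s
  rw [homogeneousProj_apply, DirectSum.decompose_of_mem_same _ (mem_homogeneousPart.1 hf s)]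

lemma eq_zero_of_homogeneousProj_eq_zero {f : S →₀ C} (hf : ∀ n, homogeneousProj 𝒞 S n f = 0) :
    f = 0 := by
  ext s
  apply (DirectSum.decompose 𝒞).injective
  rw [Finsupp.zero_apply, DirectSum.decompose_zero]
  ext n
  rw [← homogeneousProj_apply, hf n]
  rfl

/-- A `C`-linear map which sends the standard basis vectors to families of elements of `C_1`
commutes with the projections to homogeneous parts, up to the shift by one. -/
lemma homogeneousProj_map {d : (S →₀ C) →ₗ[C] (S' →₀ C)}
    (hd : ∀ s, d (Finsupp.single s 1) ∈ homogeneousPart 𝒞 S' 1) (n : ℕ) (f : S →₀ C) :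
    homogeneousProj 𝒞 S' (n + 1) (d f) = d (homogeneousProj 𝒞 S n f) := by
  induction f using Finsupp.induction_linear with
  | zero => simp
  | add f g hf hg => simp only [map_add, hf, hg]
  | single s c =>
    have h : homogeneousProj 𝒞 S n (Finsupp.single s c) =
        (DirectSum.decompose 𝒞 c n : C) • Finsupp.single s 1 := by
      rw [Finsupp.smul_single, smul_eq_mul, mul_one]
      exact Finsupp.mapRange_single (hf := map_zero (GradedAlgebra.proj 𝒞 n))
    rw [h, map_smul, ← mul_one c, ← smul_eq_mul c 1, ← Finsupp.smul_single, map_smul, smul_eq_mul,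
      mul_one]
    ext s'
    rw [homogeneousProj_apply, Finsupp.smul_apply, Finsupp.smul_apply, smul_eq_mul, smul_eq_mul,
      DirectSum.coe_decompose_mul_add_of_right_mem 𝒞 (mem_homogeneousPart.1 (hd s) s')]

lemma homogeneousProj_zero_map {d : (S →₀ C) →ₗ[C] (S' →₀ C)}
    (hd : ∀ s, d (Finsupp.single s 1) ∈ homogeneousPart 𝒞 S' 1) (f : S →₀ C) :
    homogeneousProj 𝒞 S' 0 (d f) = 0 := by
  induction f using Finsupp.induction_linear with
  | zero => simp
  | add f g hf hg => simp only [map_add, hf, hg, add_zero]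
  | single s c =>
    rw [← mul_one c, ← smul_eq_mul c 1, ← Finsupp.smul_single, map_smul]
    ext s'
    rw [homogeneousProj_apply, Finsupp.smul_apply, smul_eq_mul,
      DirectSum.coe_decompose_mul_of_right_mem_of_not_le 𝒞 (mem_homogeneousPart.1 (hd s) s')
        (by omega), Finsupp.zero_apply]

lemma map_mem_homogeneousPart {d : (S →₀ C) →ₗ[C] (S' →₀ C)}
    (hd : ∀ s, d (Finsupp.single s 1) ∈ homogeneousPart 𝒞 S' 1) {n : ℕ} {f : S →₀ C}
    (hf : f ∈ homogeneousPart 𝒞 S n) : d f ∈ homogeneousPart 𝒞 S' (n + 1) := by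
  rw [← homogeneousProj_of_mem hf, ← homogeneousProj_map hd]
  exact homogeneousProj_mem _ _

lemma map_homogeneousPart {d : (S →₀ C) →ₗ[C] (S' →₀ C)}
    (hd : ∀ s, d (Finsupp.single s 1) ∈ homogeneousPart 𝒞 S' 1) (n : ℕ) :
    (homogeneousPart 𝒞 S n).map (d.restrictScalars k) =
      homogeneousPart 𝒞 S' (n + 1) ⊓ (LinearMap.range d).restrictScalars k := by
  ext g
  simp only [Submodule.mem_map, LinearMap.coe_restrictScalars, Submodule.mem_inf,
    Submodule.restrictScalars_mem, LinearMap.mem_range]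
  constructor
  · rintro ⟨f, hf, rfl⟩
    exact ⟨map_mem_homogeneousPart hd hf, f, rfl⟩
  · rintro ⟨hg, f, rfl⟩
    exact ⟨homogeneousProj 𝒞 S n f, homogeneousProj_mem _ _,
      by rw [← homogeneousProj_map hd, homogeneousProj_of_mem hg]⟩

lemma map_mem_freeGrading {d : (S →₀ C) →ₗ[C] (S' →₀ C)}
    (hd : ∀ s, d (Finsupp.single s 1) ∈ homogeneousPart 𝒞 S' 1) {i n : ℕ} {f : S →₀ C}
    (hf : f ∈ freeGrading 𝒞 S (i + 1) n) : d f ∈ freeGrading 𝒞 S' i n := by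
  by_cases h : i + 1 ≤ n
  · intro s'
    have hf' : f ∈ homogeneousPart 𝒞 S (n - (i + 1)) :=
      mem_homogeneousPart.2 fun s => by simpa [h] using hf s
    have := mem_homogeneousPart.1 (map_mem_homogeneousPart hd hf') s'
    rw [if_pos (by omega)]
    rwa [show n - (i + 1) + 1 = n - i by omega] at this
  · have hf' : f = 0 := by
      ext s
      simpa [h] using hf s
    rw [hf', map_zero]
    exact zero_mem _

lemma finrank_map_add_finrank_inf_ker {M N : Type*} [AddCommGroup M] [Module k M]
    [AddCommGroup N] [Module k N] (p : Submodule k M) [Module.Finite k p] (f : M →ₗ[k] N) :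
    Module.finrank k (p.map f) + Module.finrank k (p ⊓ LinearMap.ker f : Submodule k M) =
      Module.finrank k p := by
  rw [← LinearMap.finrank_range_add_finrank_ker (f.domRestrict p), LinearMap.range_domRestrict,
    LinearMap.ker_domRestrict, ← Submodule.map_comap_subtype, Submodule.finrank_map_subtype_eq]

end HomogeneousParts

/-! ### Linear resolutions of length two -/

section LengthTwo

universe u v

variable {k : Type u} [Field k] {C : Type v} [Ring C] [Algebra k C] {𝒞 : ℕ → Submodule k C}
  [GradedAlgebra 𝒞]

/-- A linear free resolution `0 → C ⊗ k^{S₂} → C ⊗ k^{S₁} → C → k → 0` shows that `C` is Koszul; the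
hypothesis `h₀` is exactness at `C`. -/
theorem isKoszul_of_length_two {S₁ S₂ : Type v}
    (d₁ : (S₁ →₀ C) →ₗ[C] (PUnit.{v + 1} →₀ C)) (d₂ : (S₂ →₀ C) →ₗ[C] (S₁ →₀ C))
    (hd₁ : ∀ s, d₁ (Finsupp.single s 1) ∈ homogeneousPart 𝒞 PUnit 1)
    (hd₂ : ∀ s, d₂ (Finsupp.single s 1) ∈ homogeneousPart 𝒞 S₁ 1)
    (h₀ : ∀ f : PUnit.{v + 1} →₀ C,
      f PUnit.unit ∈ augmentationIdeal 𝒞 ↔ f ∈ LinearMap.range d₁)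
    (h₁ : Function.Exact d₂ d₁) (h₂ : Function.Injective d₂) : IsKoszul 𝒞 := by
  let S : ℕ → Type v
    | 0 => PUnit
    | 1 => S₁
    | 2 => S₂
    | _ + 3 => PEmpty
  let d : ∀ i, (S (i + 1) →₀ C) →ₗ[C] (S i →₀ C)
    | 0 => d₁
    | 1 => d₂
    | _ + 2 => 0
  refine ⟨S, d, (augmentationIdeal 𝒞).mkQ ∘ₗ Finsupp.lapply PUnit.unit, ?_, ?_, ?_, ?_⟩
  · rintro (_ | _ | i) n f hf
    · exact map_mem_freeGrading hd₁ hf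
    · exact map_mem_freeGrading hd₂ hf
    · exact zero_mem _
  · intro x
    obtain ⟨c, rfl⟩ := (augmentationIdeal 𝒞).mkQ_surjective x
    exact ⟨Finsupp.single PUnit.unit c, by simp⟩
  · intro f
    change (augmentationIdeal 𝒞).mkQ (f PUnit.unit) = 0 ↔ _
    rw [Submodule.mkQ_apply, Submodule.Quotient.mk_eq_zero]
    exact h₀ f
  · rintro (_ | _ | i)
    · exact h₁
    · intro f
      change d₂ f = 0 ↔ _
      rw [map_eq_zero_iff d₂ h₂]
      exact ⟨fun h => ⟨0, h ▸ rfl⟩, fun ⟨g, hg⟩ => hg ▸ rfl⟩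
    · intro f
      exact ⟨fun _ => ⟨0, Finsupp.ext fun s => s.elim⟩, fun _ => rfl⟩

end LengthTwo

/-! ### Quadratic algebras with the Hilbert series of global dimension two -/

section Quadratic

universe u v

variable {k : Type u} [Field k] {C : Type v} [Ring C] [Algebra k C] {𝒞 : ℕ → Submodule k C}

lemma IsQuadratic.mem_quadraticIdeal (h : IsQuadratic 𝒞) {t : TensorAlgebra k (𝒞 1)}
    (ht : canonicalMap 𝒞 t = 0) : t ∈ quadraticIdeal 𝒞 := by
  have h0 : ((t : QuadraticPart 𝒞)) = ((0 : TensorAlgebra k (𝒞 1)) : QuadraticPart 𝒞) := by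
    apply h.2.1
    change canonicalMap 𝒞 t = canonicalMap 𝒞 0
    rw [ht, map_zero]
  exact (TwoSidedIdeal.mem_iff _ _).2 ((RingCon.eq _).1 h0)

variable {ι : Type*} (b : Module.Basis ι k (𝒞 1))

lemma foxDerivative_surjective (h : IsOneGenerated 𝒞) :
    Function.Surjective (foxDerivative (𝒞 1).subtype b) := by
  rw [← LinearMap.range_eq_top, eq_top_iff]
  rintro f -
  induction f using Finsupp.induction_linear with
  | zero => exact zero_mem _
  | add f g hf hg => exact add_mem hf hg
  | single i c =>
    obtain ⟨s, rfl⟩ := h c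
    refine ⟨s * TensorAlgebra.ι k (b i), ?_⟩
    rw [foxDerivative_mul_ι, unitTensor_basis, Finsupp.smul_single, smul_eq_mul, mul_one]
    rfl

lemma multiplicationMap_single_mem (i : ι) :
    multiplicationMap (𝒞 1).subtype b (Finsupp.single i 1) ∈ homogeneousPart 𝒞 PUnit.{v + 1} 1 :=
  mem_homogeneousPart.2 fun _ => by simp [multiplicationMap]

/-- The quadratic relations of `C`: the kernel of the multiplication map
`C_1 ⊗ C_1 → C_2`, as a subspace of the free module `C ⊗ C_1`. -/
def relations : Submodule k (ι →₀ C) :=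
  homogeneousPart 𝒞 ι 1 ⊓ LinearMap.ker ((multiplicationMap (𝒞 1).subtype b).restrictScalars k)

/-- The map `C ⊗ R → C ⊗ C_1` induced by the inclusion of the relations, in coordinates given by a
basis of the space of relations. -/
def relationMap {κ : Type*} (c : Module.Basis κ k (relations b)) : (κ →₀ C) →ₗ[C] (ι →₀ C) :=
  Finsupp.linearCombination C fun s => (c s : ι →₀ C)

lemma relationMap_unitTensor {κ : Type*} (c : Module.Basis κ k (relations b)) (r : relations b) :
    relationMap b c (unitTensor c r) = r := by
  have h : (relationMap b c).restrictScalars k ∘ₗ unitTensor c = (relations b).subtype :=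
    c.ext fun i => by simp [relationMap, unitTensor_basis]
  exact LinearMap.congr_fun h r

lemma relationMap_single_mem {κ : Type*} (c : Module.Basis κ k (relations b)) (s : κ) :
    relationMap b c (Finsupp.single s 1) ∈ homogeneousPart 𝒞 ι 1 := by
  simpa [relationMap] using (c s).2.1

variable [GradedAlgebra 𝒞]

lemma unitTensor_mem (v : 𝒞 1) : unitTensor (C := C) b v ∈ homogeneousPart 𝒞 ι 0 :=
  mem_homogeneousPart.2 fun i => by
    simpa [unitTensor] using SetLike.algebraMap_mem_graded 𝒞 (b.repr v i)

/-- The Fox derivative of an element of `C_1 ⊗ C_1` is a family of elements of `C_1`. -/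
lemma foxDerivative_of_mem_range_ι_sq {t : TensorAlgebra k (𝒞 1)}
    (ht : t ∈ LinearMap.range (TensorAlgebra.ι k (M := 𝒞 1)) ^ 2) :
    TensorAlgebra.algebraMapInv t = 0 ∧
      foxDerivative (𝒞 1).subtype b t ∈ homogeneousPart 𝒞 ι 1 := by
  rw [pow_two] at ht
  induction ht using Submodule.mul_induction_on' with
  | mem_mul_mem x hx y hy =>
    obtain ⟨v, rfl⟩ := hx
    obtain ⟨w, rfl⟩ := hy
    refine ⟨by simp [TensorAlgebra.algebraMapInv], ?_⟩
    rw [foxDerivative_mul_ι, TensorAlgebra.lift_ι_apply]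
    refine mem_homogeneousPart.2 fun i => ?_
    exact SetLike.mul_mem_graded v.2 (mem_homogeneousPart.1 (unitTensor_mem b w) i)
  | add x _ y _ hx hy =>
    rw [map_add, map_add]
    exact ⟨by rw [hx.1, hy.1, add_zero], add_mem hx.2 hy.2⟩

/-- Exactness of `C ⊗ C_1 → C → k → 0` for a one-generated algebra. -/
lemma mem_augmentationIdeal_iff (h : IsOneGenerated 𝒞) (f : PUnit.{v + 1} →₀ C) :
    f PUnit.unit ∈ augmentationIdeal 𝒞 ↔
      f ∈ LinearMap.range (multiplicationMap (𝒞 1).subtype b) := by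
  have hf : f PUnit.unit ∈ augmentationIdeal 𝒞 ↔ homogeneousProj 𝒞 PUnit 0 f = 0 := by
    rw [Finsupp.ext_iff]
    exact ⟨fun h _ => h, fun h => h PUnit.unit⟩
  rw [hf]
  constructor
  · intro h0
    obtain ⟨t, ht⟩ := h (f PUnit.unit)
    have h1 := multiplicationMap_foxDerivative (𝒞 1).subtype b t
    change _ = Finsupp.single PUnit.unit (canonicalMap 𝒞 t - _) at h1
    rw [ht, Finsupp.single_sub, ← Finsupp.unique_single f] at h1
    set g : PUnit.{v + 1} →₀ C :=
      Finsupp.single PUnit.unit (algebraMap k C (TensorAlgebra.algebraMapInv t))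
    have hg : g ∈ homogeneousPart 𝒞 PUnit.{v + 1} 0 :=
      mem_homogeneousPart.2 fun _ => by
        simpa [g] using SetLike.algebraMap_mem_graded 𝒞 (TensorAlgebra.algebraMapInv t)
    have hg0 : g = 0 := by
      have := homogeneousProj_zero_map (multiplicationMap_single_mem b)
        (foxDerivative (𝒞 1).subtype b t)
      rwa [h1, map_sub, h0, homogeneousProj_of_mem hg, zero_sub, neg_eq_zero] at this
    rw [hg0, sub_zero] at h1
    exact ⟨_, h1⟩
  · rintro ⟨g, rfl⟩
    exact homogeneousProj_zero_map (multiplicationMap_single_mem b) g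

/-- Quadraticity is exactness of `C ⊗ R → C ⊗ C_1 → C` in the middle. -/
lemma exact_relationMap_multiplicationMap (h : IsQuadratic 𝒞) {κ : Type*}
    (c : Module.Basis κ k (relations b)) :
    Function.Exact (relationMap b c) (multiplicationMap (𝒞 1).subtype b) := by
  rw [LinearMap.exact_iff]
  apply le_antisymm
  · intro f hf
    obtain ⟨t, rfl⟩ := foxDerivative_surjective b h.1 f
    -- Subtracting the constant term does not change the Fox derivative.
    set a := algebraMap k (TensorAlgebra k (𝒞 1)) (TensorAlgebra.algebraMapInv t) with ha
    have hta : foxDerivative (𝒞 1).subtype b (t - a) = foxDerivative (𝒞 1).subtype b t := by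
      rw [map_sub, ha, foxDerivative_algebraMap, sub_zero]
    have h0 : canonicalMap 𝒞 (t - a) = 0 := by
      have := multiplicationMap_foxDerivative (𝒞 1).subtype b t
      rw [LinearMap.mem_ker.1 hf, eq_comm, Finsupp.single_eq_zero] at this
      rwa [map_sub, ha, AlgHom.commutes]
    rw [← hta]
    refine foxDerivative_mem_of_mem_span _ b _ ?_ (h.mem_quadraticIdeal h0)
    rintro r ⟨hr, hr0⟩
    obtain ⟨hε, hD⟩ := foxDerivative_of_mem_range_ι_sq b hr
    have hrel : foxDerivative (𝒞 1).subtype b r ∈ relations b := by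
      refine ⟨hD, ?_⟩
      change multiplicationMap (𝒞 1).subtype b _ = 0
      rw [multiplicationMap_foxDerivative, hε, map_zero, sub_zero, Finsupp.single_eq_zero]
      exact hr0
    exact ⟨hr0, hε, unitTensor c ⟨_, hrel⟩, relationMap_unitTensor b c ⟨_, hrel⟩⟩
  · rw [LinearMap.range_le_ker_iff]
    refine Finsupp.lhom_ext' fun s => LinearMap.ext_ring ?_
    simpa [relationMap] using (c s).2.2

/-- Let `C` be a quadratic algebra with Hilbert series `H(t)` satisfying
`H(t) (1 - h₁ t + w t²) = 1`. Then `C` is Koszul: the Hilbert series forces the Euler characteristic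
of `0 → C ⊗ R → C ⊗ C_1 → C → k → 0` to vanish in each degree, so that exactness elsewhere implies
exactness at `C ⊗ R`. -/
theorem isKoszul_of_isQuadratic [∀ n, Module.Finite k (𝒞 n)] (hC : IsQuadratic 𝒞) (w : ℕ)
    (h0 : Module.finrank k (𝒞 0) = 1)
    (h : ∀ n, Module.finrank k (𝒞 (n + 2)) + w * Module.finrank k (𝒞 n) =
      Module.finrank k (𝒞 1) * Module.finrank k (𝒞 (n + 1))) : IsKoszul 𝒞 := by
  let b := Module.Basis.ofVectorSpace k (𝒞 1)
  have : Finite (Module.Basis.ofVectorSpaceIndex k (𝒞 1)) := Module.Finite.finite_basis b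
  have : Module.Finite k (relations b) :=
    Submodule.finiteDimensional_inf_left _ _
  let c := Module.Basis.ofVectorSpace k (relations b)
  have : Finite (Module.Basis.ofVectorSpaceIndex k (relations b)) := Module.Finite.finite_basis c
  have hex := exact_relationMap_multiplicationMap b hC c
  refine isKoszul_of_length_two (multiplicationMap (𝒞 1).subtype b) (relationMap b c)
    (multiplicationMap_single_mem b) (relationMap_single_mem b c)
    (mem_augmentationIdeal_iff b hC.1) hex ?_
  -- The dimension of the kernel of `C_n ⊗ C_1 → C_{n+1}`.
  have hker : ∀ n, Module.finrank k (𝒞 (n + 1)) + Module.finrank k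
      (homogeneousPart 𝒞 (Module.Basis.ofVectorSpaceIndex k (𝒞 1)) n ⊓
        LinearMap.ker ((multiplicationMap (𝒞 1).subtype b).restrictScalars k) :
          Submodule k _) = Module.finrank k (𝒞 1) * Module.finrank k (𝒞 n) := by
    intro n
    have h1 := finrank_map_add_finrank_inf_ker
      (homogeneousPart 𝒞 (Module.Basis.ofVectorSpaceIndex k (𝒞 1)) n)
      ((multiplicationMap (𝒞 1).subtype b).restrictScalars k)
    have h2 : homogeneousPart 𝒞 PUnit.{v + 1} (n + 1) ≤
        (LinearMap.range (multiplicationMap (𝒞 1).subtype b)).restrictScalars k := fun f hf =>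
      (mem_augmentationIdeal_iff b hC.1 f).1 <|
        HomogeneousIdeal.mem_irrelevant_of_mem 𝒞 n.succ_pos (mem_homogeneousPart.1 hf _)
    rw [map_homogeneousPart (multiplicationMap_single_mem b), inf_eq_left.2 h2,
      finrank_homogeneousPart, finrank_homogeneousPart, ← Module.finrank_eq_nat_card_basis b] at h1
    simpa using h1
  have hcard : Nat.card (Module.Basis.ofVectorSpaceIndex k (relations b)) = w := by
    have h1 := hker 1
    have h2 := h 0
    rw [← Module.finrank_eq_nat_card_basis c]
    rw [h0, mul_one] at h2
    exact Nat.add_left_cancel (h1.trans h2.symm)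
  have hbot : ∀ n, homogeneousPart 𝒞 (Module.Basis.ofVectorSpaceIndex k (relations b)) n ⊓
      LinearMap.ker ((relationMap b c).restrictScalars k) = ⊥ := by
    intro n
    have h1 := finrank_map_add_finrank_inf_ker
      (homogeneousPart 𝒞 (Module.Basis.ofVectorSpaceIndex k (relations b)) n)
      ((relationMap b c).restrictScalars k)
    rw [map_homogeneousPart (relationMap_single_mem b c), ← LinearMap.exact_iff.1 hex,
      finrank_homogeneousPart, hcard] at h1
    have h2 := hker (n + 1)
    rw [← h n] at h2
    have : Module.Finite k (homogeneousPart 𝒞 (Module.Basis.ofVectorSpaceIndex k (relations b)) n ⊓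
      LinearMap.ker ((relationMap b c).restrictScalars k) : Submodule k _) :=
      Submodule.finiteDimensional_inf_left _ _
    rw [← Submodule.finrank_eq_zero (R := k)]
    change Module.finrank k (homogeneousPart 𝒞 _ (n + 1) ⊓ LinearMap.ker
      ((multiplicationMap (𝒞 1).subtype b).restrictScalars k) : Submodule k _) + _ = _ at h1
    exact Nat.add_left_cancel (k := 0) (h1.trans (Nat.add_left_cancel h2).symm)
  rw [injective_iff_map_eq_zero]
  refine fun f hf => eq_zero_of_homogeneousProj_eq_zero (𝒞 := 𝒞) fun n => ?_
  have : homogeneousProj 𝒞 _ n f ∈ homogeneousPart 𝒞 _ n ⊓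
      LinearMap.ker ((relationMap b c).restrictScalars k) := by
    refine ⟨homogeneousProj_mem n f, ?_⟩
    change relationMap b c _ = 0
    rw [← homogeneousProj_map (relationMap_single_mem b c), hf, map_zero]
  rwa [hbot n] at this

end Quadratic

/-! ### The Hilbert function of a twisted tensor product of free algebras -/

section HilbertFunction

variable {k : Type*} [Field k]

/-- A graded piece has the homogeneous basis vectors of its degree as a basis. -/
lemma eq_span_of_homogeneous_basis {M I : Type*} [AddCommGroup M] [Module k M]
    (ℳ : ℕ → Submodule k M) [DirectSum.Decomposition ℳ] (b : Module.Basis I k M) (deg : I → ℕ)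
    (hb : ∀ i, b i ∈ ℳ (deg i)) (n : ℕ) :
    ℳ n = Submodule.span k (b '' {i | deg i = n}) := by
  apply le_antisymm
  · intro x hx
    rw [b.mem_span_image]
    intro i hi
    by_contra hn
    -- The coordinate of a degree `n` component at a vector of another degree vanishes.
    classical
    have h : b.coord i ∘ₗ (ℳ n).subtype ∘ₗ DirectSum.component k ℕ (fun n => ℳ n) n ∘ₗ
        (DirectSum.decomposeLinearEquiv ℳ).toLinearMap = 0 := by
      refine b.ext fun j => ?_
      simp only [LinearMap.coe_comp, LinearEquiv.coe_coe, Function.comp_apply,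
        DirectSum.decomposeLinearEquiv_apply, LinearMap.zero_apply]
      change b.repr (DirectSum.decompose ℳ (b j) n : M) i = 0
      by_cases hj : deg j = n
      · subst hj
        rw [DirectSum.decompose_of_mem_same _ (hb j), b.repr_self, Finsupp.single_apply, if_neg]
        rintro rfl
        exact hn rfl
      · rw [DirectSum.decompose_of_mem_ne _ (hb j) hj, map_zero, Finsupp.zero_apply]
    have hx0 := LinearMap.congr_fun h x
    change b.repr (DirectSum.decompose ℳ x n : M) i = 0 at hx0
    rw [DirectSum.decompose_of_mem_same _ hx] at hx0
    exact Finsupp.mem_support_iff.1 hi hx0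
  · rw [Submodule.span_le]
    rintro _ ⟨i, rfl, rfl⟩
    exact hb i

lemma finite_of_homogeneous_basis {M I : Type*} [AddCommGroup M] [Module k M]
    (ℳ : ℕ → Submodule k M) [DirectSum.Decomposition ℳ] (b : Module.Basis I k M) (deg : I → ℕ)
    (hb : ∀ i, b i ∈ ℳ (deg i)) (n : ℕ) [Finite {i // deg i = n}] : Module.Finite k (ℳ n) := by
  rw [eq_span_of_homogeneous_basis ℳ b deg hb n]
  exact Module.Finite.span_of_finite k (((Set.finite_coe_iff (s := {i | deg i = n})).1 ‹_›).image b)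

lemma finrank_of_homogeneous_basis {M I : Type*} [AddCommGroup M] [Module k M]
    (ℳ : ℕ → Submodule k M) [DirectSum.Decomposition ℳ] (b : Module.Basis I k M) (deg : I → ℕ)
    (hb : ∀ i, b i ∈ ℳ (deg i)) (n : ℕ) [Finite {i // deg i = n}] :
    Module.finrank k (ℳ n) = Nat.card {i // deg i = n} := by
  have := Fintype.ofFinite {i // deg i = n}
  have h : b '' {i | deg i = n} = Set.range fun i : {i // deg i = n} => b i := by
    ext x; simp
  rw [eq_span_of_homogeneous_basis ℳ b deg hb n, h, Nat.card_eq_fintype_card]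
  exact finrank_span_eq_card (b.linearIndependent.comp _ Subtype.val_injective)

/-- A one-generated free algebra has a homogeneous basis, consisting of the words in the
generators. -/
lemma IsFreeOneGenerated.exists_basis {A : Type*} [Ring A] [Algebra k A] {𝒜 : ℕ → Submodule k A}
    [GradedAlgebra 𝒜] (h : IsFreeOneGenerated 𝒜) :
    ∃ (m : ℕ) (b : Module.Basis (FreeMonoid (Fin m)) k A), ∀ u, b u ∈ 𝒜 u.length := by
  obtain ⟨m, x, hx, hbij⟩ := h
  refine ⟨m, (FreeAlgebra.basisFreeMonoid k (Fin m)).map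
    (AlgEquiv.ofBijective _ hbij).toLinearEquiv, fun u => ?_⟩
  have hlift : ((FreeAlgebra.lift k x).comp
      FreeAlgebra.equivMonoidAlgebraFreeMonoid.symm.toAlgHom).toMonoidHom.comp
        (MonoidAlgebra.of k (FreeMonoid (Fin m))) = FreeMonoid.lift x :=
    FreeMonoid.hom_eq fun i => by simp [FreeAlgebra.equivMonoidAlgebraFreeMonoid]
  have hu : ((FreeAlgebra.basisFreeMonoid k (Fin m)).map
      (AlgEquiv.ofBijective _ hbij).toLinearEquiv) u = FreeMonoid.lift x u := by
    rw [← hlift]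
    simp [FreeAlgebra.basisFreeMonoid]
  rw [hu]
  clear hu
  induction u using FreeMonoid.inductionOn' with
  | one => simpa using SetLike.one_mem_graded 𝒜
  | of_mul i u ih =>
    rw [map_mul, FreeMonoid.lift_eval_of, FreeMonoid.length_mul, FreeMonoid.length_of]
    exact SetLike.mul_mem_graded (hx i) ih

/-- The pairs of words of total length `d`, sorted by the lengths of the two words. -/
def wordPairsEquiv (X Y : Type*) (d : ℕ) :
    {p : FreeMonoid X × FreeMonoid Y // p.1.length + p.2.length = d} ≃
      Σ p : Finset.HasAntidiagonal.antidiagonal d,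
        {u : FreeMonoid X // u.length = p.1.1} × {v : FreeMonoid Y // v.length = p.1.2} where
  toFun p := ⟨⟨(p.1.1.length, p.1.2.length), Finset.HasAntidiagonal.mem_antidiagonal.2 p.2⟩,
    ⟨p.1.1, rfl⟩, ⟨p.1.2, rfl⟩⟩
  invFun q := ⟨(q.2.1, q.2.2), by
    rw [q.2.1.2, q.2.2.2]; exact Finset.HasAntidiagonal.mem_antidiagonal.1 q.1.2⟩
  left_inv _ := rfl
  right_inv q := by
    obtain ⟨⟨⟨_, _⟩, _⟩, ⟨_, h⟩, ⟨_, h'⟩⟩ := q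
    dsimp only at h h'
    subst h h'
    rfl

instance (X : Type*) [Finite X] (d : ℕ) : Finite {u : FreeMonoid X // u.length = d} := by
  have := Fintype.ofFinite X
  exact inferInstanceAs (Finite (List.Vector X d))

lemma card_words (m d : ℕ) : Nat.card {u : FreeMonoid (Fin m) // u.length = d} = m ^ d := by
  change Nat.card (List.Vector (Fin m) d) = _
  rw [Nat.card_eq_fintype_card, card_vector, Fintype.card_fin]

instance (X Y : Type*) [Finite X] [Finite Y] (d : ℕ) :
    Finite {p : FreeMonoid X × FreeMonoid Y // p.1.length + p.2.length = d} :=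
  Finite.of_equiv _ (wordPairsEquiv X Y d).symm

lemma card_wordPairs (m n d : ℕ) :
    Nat.card {p : FreeMonoid (Fin m) × FreeMonoid (Fin n) // p.1.length + p.2.length = d} =
      ∑ p ∈ Finset.HasAntidiagonal.antidiagonal d, m ^ p.1 * n ^ p.2 := by
  rw [Nat.card_congr (wordPairsEquiv _ _ d), Nat.card_sigma,
    ← Finset.sum_coe_sort (Finset.HasAntidiagonal.antidiagonal d) fun p => m ^ p.1 * n ^ p.2]
  simp only [Nat.card_prod, card_words]

lemma sum_antidiagonal_pow_recurrence (m n d : ℕ) :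
    ∑ p ∈ Finset.HasAntidiagonal.antidiagonal (d + 2), m ^ p.1 * n ^ p.2 +
      m * n * ∑ p ∈ Finset.HasAntidiagonal.antidiagonal d, m ^ p.1 * n ^ p.2 =
      (m + n) * ∑ p ∈ Finset.HasAntidiagonal.antidiagonal (d + 1), m ^ p.1 * n ^ p.2 := by
  have h₁ : ∀ d, ∑ p ∈ Finset.HasAntidiagonal.antidiagonal (d + 1), m ^ p.1 * n ^ p.2 =
      n ^ (d + 1) + m * ∑ p ∈ Finset.HasAntidiagonal.antidiagonal d, m ^ p.1 * n ^ p.2 := fun d => by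
    rw [Finset.Nat.sum_antidiagonal_succ, Finset.mul_sum]
    simp [pow_succ', mul_assoc]
  rw [h₁ (d + 1), add_mul m n, h₁ d]
  ring

variable {A B : Type*} [Ring A] [Algebra k A] [Ring B] [Algebra k B]
  {𝒜 : ℕ → Submodule k A} [GradedAlgebra 𝒜] {ℬ : ℕ → Submodule k B} [GradedAlgebra ℬ]

/-- The dimensions of the graded pieces of `A ⊗_τ B` do not depend on `τ`: pairs of words form a
homogeneous basis. -/
lemma exists_finrank_grading (hA : IsFreeOneGenerated 𝒜) (hB : IsFreeOneGenerated ℬ)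
    (τ : GradedTwistingMap 𝒜 ℬ) : ∃ m n : ℕ, ∀ d, Module.Finite k (τ.grading d) ∧
      Module.finrank k (τ.grading d) =
        ∑ p ∈ Finset.HasAntidiagonal.antidiagonal d, m ^ p.1 * n ^ p.2 := by
  obtain ⟨m, bA, hbA⟩ := hA.exists_basis
  obtain ⟨n, bB, hbB⟩ := hB.exists_basis
  let b := (bA.tensorProduct bB).map (TwistedTensorProduct.of τ.toTwistingMap)
  have hb : ∀ p, b p ∈ τ.grading (p.1.length + p.2.length) := fun p =>
    ⟨bA p.1 ⊗ₜ bB p.2, Submodule.subset_span ⟨_, _, rfl, _, hbA _, _, hbB _, rfl⟩,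
      by simp [b, Module.Basis.tensorProduct_apply']⟩
  refine ⟨m, n, fun d => ⟨finite_of_homogeneous_basis _ b _ hb d, ?_⟩⟩
  rw [finrank_of_homogeneous_basis _ b _ hb d, card_wordPairs]

end HilbertFunction

end TwistedProduct

end

theorem proposition5p5 {k A B : Type*} [Field k] [Ring A] [Algebra k A] [Ring B] [Algebra k B]
    (𝒜 : ℕ → Submodule k A) [GradedAlgebra 𝒜] (ℬ : ℕ → Submodule k B) [GradedAlgebra ℬ]
    (hA : TwistedProduct.IsFreeOneGenerated 𝒜) (hB : TwistedProduct.IsFreeOneGenerated ℬ)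
    (τ : TwistedProduct.GradedTwistingMap 𝒜 ℬ)
    (hτ : TwistedProduct.IsQuadratic τ.grading) :
    TwistedProduct.IsKoszul τ.grading := by
  obtain ⟨m, n, h⟩ := TwistedProduct.exists_finrank_grading hA hB τ
  have := fun d => (h d).1
  have h1 : Module.finrank k (τ.grading 1) = m + n := by
    rw [(h 1).2, Finset.Nat.sum_antidiagonal_succ]
    simp [add_comm]
  refine TwistedProduct.isKoszul_of_isQuadratic hτ (m * n) (by simp [(h 0).2]) fun d => ?_
  rw [h1, (h _).2, (h _).2, (h _).2, TwistedProduct.sum_antidiagonal_pow_recurrence]
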